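/- **Setting.** Let $n,p\ge 1$, $0\le r\le p$, $0\le q\le n$, $d=p-r$ and $\sigma\ge 0$. A parameter is a quadruple $\theta=(A,S,V,V_\perp)$ with $A\in\mathbb R^{n\times r}$, $S\in\mathbb R^{n\times d}$, $V\in\mathbb R^{p\times r}$, $V_\perp\in\mathbb R^{p\times d}$ and $[V,V_\perp]$ a $p\times p$ orthogonal matrix; its signal is $B(\theta)=AV^T+SV_\perp^T$. Write $\|S\|_{2,0}$ for the number of nonzero rows of $S$, and $M(\theta;\theta')=\frac1{np}\|B(\theta)-B(\theta')\|_F^2$. For a data matrix $X\in\mathbb R^{n\times p}$ the row-sparse ROC-PCA problem is $$\min_{S,V_\perp,A,V}\ \|X-AV^T-SV_\perp^T\|_F^2\quad\text{s.t. } \|S\|_{2,0}\le q,\ [V,V_\perp]\in\mathbb O^{p\times p}.\qquad(\ast)$$ The $\psi_2$-norm of a real random variable is $\|\xi\|_{\psi_2}=\inf\{K>0:\mathbb E\exp(\xi^2/K^2)\le 2\}$, and $\xi$ is sub-Gaussian if $\mathbb P(|\xi|\ge t)\le Ce^{-ct^2}$ for all $t>0$, for some $C,c>0$. A random matrix $E\in\mathbb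 R^{n\times p}$ is sub-Gaussian with scale bounded by $\sigma$ if, for every $a\in\mathbb R^{n\times p}$, $\langle E,a\rangle$ is sub-Gaussian with $\|\langle E,a\rangle\|_{\psi_2}\le\sigma\|a\|_F$. **Theorem.** (i) Let $X=B(\theta^*)+E$, where $\theta^*=(A^*,S^*,V^*,V_\perp^*)$ is any parameter ($S^*$ need not be sparse) and the random matrix $E$ either has i.i.d. $\mathcal N(0,\sigma^2)$ entries or is sub-Gaussian with scale bounded by $\sigma$. Let $\hat\theta=(\hat A,\hat S,\hat V,\hat V_\perp)$ be any (random) globally optimal point of $(\ast)$. Then for every parameter $\theta=(A,S,V,V_\perp)$ with $\|S\|_{2,0}\le q$, $$\mathbb E\,M(\hat\theta;\theta^*)\ \le\ C\Big\{M(\theta;\theta^*)+\frac{\sigma^2\{qp+rn+rp+q\log(en/q)\}}{np}+\frac{\sigma^2}{np}\Big\},$$ where $C$ is a numerical constant (it depends on none of $n,p,r,q,\sigma$, the law of $E$, $\theta^*$, $\theta$), and $q\log(en/q)=0$ for $q=0$. (ii) For an estimator $\hat\theta(\cdot)$, mapping data matrices to parameters, define the finite-sample breakdown point at noise level $\sigma$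 by $$\epsilon^*(\hat\theta)=\frac1n\min\Big\{k\in\{0,1,2,\dots\}:\ \sup\ \mathbb E\,M\big(\hat\theta(B(\theta^*)+E);\theta^*\big)=+\infty\Big\}\qquad(\min\emptyset=+\infty),$$ where the supremum is over all parameters $\theta^*$ with $\|S^*\|_{2,0}\le k$ and all laws of random matrices $E$ that are sub-Gaussian with scale bounded by $\sigma$. If $\hat\theta(X)$ is a globally optimal point of $(\ast)$ for every $X\in\mathbb R^{n\times p}$, then $\epsilon^*(\hat\theta)\ge (q+1)/n$. -/

import Mathlib

open MeasureTheory ProbabilityTheory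
open scoped ENNReal

noncomputable section

namespace ROCPCA

/-- A quadruple `(A, S, V, V⊥)` of matrices of sizes `n × r`, `n × d`, `p × r`, `p × d`, where
`d = p - r`. -/
structure Param (n p r : ℕ) where
  A : Matrix (Fin n) (Fin r) ℝ
  S : Matrix (Fin n) (Fin (p - r)) ℝ
  V : Matrix (Fin p) (Fin r) ℝ
  Vperp : Matrix (Fin p) (Fin (p - r)) ℝ

/-- The squared Frobenius norm. -/
def frobSq {n p : ℕ} (M : Matrix (Fin n) (Fin p) ℝ) : ℝ :=
  ∑ i, ∑ j, M i j ^ 2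

/-- `‖S‖_{2,0}`: the number of nonzero rows. -/
def rowL0 {n d : ℕ} (S : Matrix (Fin n) (Fin d) ℝ) : ℕ :=
  {i : Fin n | ∃ j, S i j ≠ 0}.ncard

namespace Param

variable {n p r : ℕ}

/-- The signal matrix `B = A Vᵀ + S V⊥ᵀ`. -/
def signal (θ : Param n p r) : Matrix (Fin n) (Fin p) ℝ :=
  θ.A * θ.V.transpose + θ.S * θ.Vperp.transpose

/-- The `p × (r + (p - r))` block matrix `[V, V⊥]`. -/
def frame (θ : Param n p r) : Matrix (Fin p) (Fin r ⊕ Fin (p - r)) ℝ :=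
  Matrix.fromCols θ.V θ.Vperp

/-- `[V, V⊥]` is an orthogonal matrix. -/
def IsOrthogonal (θ : Param n p r) : Prop :=
  θ.frame.transpose * θ.frame = 1 ∧ θ.frame * θ.frame.transpose = 1

/-- The constraints `‖S‖_{2,0} ≤ q` and `[V, V⊥]` orthogonal. -/
def Feasible (q : ℕ) (θ : Param n p r) : Prop :=
  rowL0 θ.S ≤ q ∧ θ.IsOrthogonal

/-- `θ` is a globally optimal point of the row-sparse ROC-PCA problem with data matrix `X`. -/
def IsGlobalOpt (q : ℕ) (X : Matrix (Fin n) (Fin p) ℝ) (θ : Param n p r) : Prop :=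
  θ.Feasible q ∧ ∀ θ' : Param n p r, θ'.Feasible q →
    frobSq (X - θ.A * θ.V.transpose - θ.S * θ.Vperp.transpose) ≤
      frobSq (X - θ'.A * θ'.V.transpose - θ'.S * θ'.Vperp.transpose)

/-- The mean approximation error `M(θ; θstar)`. -/
def meanError (θ θstar : Param n p r) : ℝ :=
  1 / ((n : ℝ) * p) * frobSq (θ.signal - θstar.signal)

end Param

/-- The rate `P_o(q, r; n, p, σ²)`; at `q = 0` the term `q log (e n / q)` is `0`. -/
def rate (q r n p : ℕ) (σ : ℝ) : ℝ :=
  σ ^ 2 * ((q : ℝ) * p + (r : ℝ) * n + (r : ℝ) * p + q * Real.log (Real.exp 1 * n / q)) /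
    ((n : ℝ) * p)

section Noise

variable {Ω : Type*} [MeasurableSpace Ω]

/-- A sub-Gaussian random variable, by its tail. -/
def IsSubGaussian (ξ : Ω → ℝ) (μ : Measure Ω) : Prop :=
  AEMeasurable ξ μ ∧ ∃ C c : ℝ, 0 < C ∧ 0 < c ∧ ∀ t : ℝ, 0 < t →
    μ {ω | t ≤ |ξ ω|} ≤ ENNReal.ofReal (C * Real.exp (-c * t ^ 2))

/-- The `ψ₂`-norm `inf {K > 0 : 𝔼 exp (ξ² / K²) ≤ 2}`. -/
def psi2Norm (ξ : Ω → ℝ) (μ : Measure Ω) : ℝ≥0∞ :=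
  ⨅ (K : ℝ) (_ : 0 < K ∧ ∫⁻ ω, ENNReal.ofReal (Real.exp (ξ ω ^ 2 / K ^ 2)) ∂μ ≤ 2),
    ENNReal.ofReal K

/-- `vec(E)` is a sub-Gaussian random vector with scale bounded by `σ`. -/
def IsSubGaussianMatrix {n p : ℕ} (E : Ω → Matrix (Fin n) (Fin p) ℝ) (σ : ℝ) (μ : Measure Ω) :
    Prop :=
  ∀ a : Matrix (Fin n) (Fin p) ℝ,
    IsSubGaussian (fun ω => ∑ i, ∑ j, E ω i j * a i j) μ ∧
    psi2Norm (fun ω => ∑ i, ∑ j, E ω i j * a i j) μ ≤ ENNReal.ofReal (σ * √(frobSq a))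

/-- The entries of `E` are i.i.d. `N(0, σ²)`. -/
def IsIIDGaussianMatrix {n p : ℕ} (E : Ω → Matrix (Fin n) (Fin p) ℝ) (σ : ℝ) (μ : Measure Ω) :
    Prop :=
  iIndepFun (fun (ij : Fin n × Fin p) ω => E ω ij.1 ij.2) μ ∧
    ∀ i j, HasLaw (fun ω => E ω i j) (gaussianReal 0 (σ ^ 2).toNNReal) μ

end Noise

section Breakdown

variable {n p r : ℕ}

/-- The product (Borel) σ-algebra on matrices. -/
instance instMeasurableSpaceMatrix : MeasurableSpace (Matrix (Fin n) (Fin p) ℝ) :=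
  inferInstanceAs (MeasurableSpace (Fin n → Fin p → ℝ))

/-- The worst risk `sup 𝔼 M(B̂(X); B)` of an estimator over all data matrices `X = B + E` where
`B = A Vᵀ + S V⊥ᵀ` has at most `k` outlying rows and `E` has a sub-Gaussian law `ν` with scale
bounded by `σ`. -/
def worstRisk (est : Matrix (Fin n) (Fin p) ℝ → Param n p r) (σ : ℝ) (k : ℕ) : ℝ≥0∞ :=
  ⨆ (B : Param n p r) (_ : B.Feasible k) (ν : Measure (Matrix (Fin n) (Fin p) ℝ))
    (_ : IsProbabilityMeasure ν) (_ : IsSubGaussianMatrix (fun E => E) σ ν),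
    ∫⁻ E, ENNReal.ofReal ((est (B.signal + E)).meanError B) ∂ν

/-- The finite-sample breakdown point: `1 / n` times the least number `k` of outliers for which
the worst risk is infinite (`∞` if there is no such `k`). -/
def breakdownPoint (est : Matrix (Fin n) (Fin p) ℝ → Param n p r) (σ : ℝ) : ℝ≥0∞ :=
  (⨅ (k : ℕ) (_ : worstRisk est σ k = ⊤), (k : ℝ≥0∞)) / n

end Breakdown

end ROCPCA

end

open ROCPCA

/-! Let x and y be the signal errors of `θhat` and of a feasible `θ`. Optimality says ‖E - x‖² ≤ ‖E
- y‖², so everything rests on 2⟨E, x - y⟩. Outside at most 2q rows, the rows of x - y lie in a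
subspace W of dimension at most 2r. Young's inequality bounds the pairing by a fraction of ‖x - y‖²,
plus the energy of E on those rows, plus that of the projection of E on W, which is at most dim W
times the squared operator norm of E (`two_mul_inner_le`, `Param.IsGlobalOpt.frobSq_le`). This holds
for every W at once, so the data-dependent W needs no net over subspaces.

Up to constants and a factor σ², the mean of the largest row energy over q-sets is qp + q log(en/q)
+ 1, and that of the squared operator norm is n + p. Both follow from an exponential moment of a
squared norm (`HasVectorMGFBound.lintegral_exp_sq_le`) and a union bound
(`exists_dominating_of_exp_moment`).

For breakdown, the true parameter is itself feasible when it has at most q outliers; comparing with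
it leaves a bound free of its size. -/

namespace ROCPCA

/-! ### Exponential moments of squared norms and maxima -/

/-- The exponential of a quadratic form against the standard Gaussian. -/
lemma lintegral_exp_sq_div_four_gaussianReal :
    ∫⁻ g, ENNReal.ofReal (Real.exp (g ^ 2 / 4)) ∂(gaussianReal 0 1) = ENNReal.ofReal (√2) := by
  rw [gaussianReal_of_var_ne_zero 0 one_ne_zero,
    lintegral_withDensity_eq_lintegral_mul _ (measurable_gaussianPDF 0 1) (by fun_prop)]
  -- The exponent -g²/2 + g²/4 = -g²/4 is that of N(0, 2), whose normalisation differs by √2.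
  have key : ∀ g : ℝ, gaussianPDF 0 1 g * ENNReal.ofReal (Real.exp (g ^ 2 / 4))
      = ENNReal.ofReal (√2) * ENNReal.ofReal (gaussianPDFReal 0 2 g) := by
    intro g
    rw [gaussianPDF, ← ENNReal.ofReal_mul (gaussianPDFReal_nonneg _ _ _),
      ← ENNReal.ofReal_mul (by positivity)]
    congr 1
    simp only [gaussianPDFReal, NNReal.coe_one, NNReal.coe_ofNat, sub_zero, mul_one]
    have h2 : √(2 * Real.pi * 2) = √2 * √(2 * Real.pi) := by
      rw [mul_comm (2 * Real.pi), Real.sqrt_mul (by norm_num)]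
    rw [h2, mul_inv, mul_assoc, ← Real.exp_add, ← mul_assoc, ← mul_assoc,
      mul_inv_cancel₀ (by positivity), one_mul]
    congr 2
    ring
  simp only [Pi.mul_apply, key]
  rw [lintegral_const_mul _ (by fun_prop), lintegral_gaussianPDFReal_eq_one 0 two_ne_zero, mul_one]

lemma lintegral_exp_mul_gaussianReal (t : ℝ) (v : NNReal) :
    ∫⁻ g, ENNReal.ofReal (Real.exp (t * g)) ∂(gaussianReal 0 v)
      = ENNReal.ofReal (Real.exp (v * t ^ 2 / 2)) := by
  rw [← ofReal_integral_eq_lintegral_ofReal (integrable_exp_mul_gaussianReal t)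
    (ae_of_all _ fun _ => (Real.exp_pos _).le)]
  have := congrFun (mgf_fun_id_gaussianReal (μ := 0) (v := v)) t
  simp only [mgf, zero_mul, zero_add] at this
  rw [this]

lemma lintegral_pi_prod {ι : Type*} [Fintype ι] (ν : Measure ℝ) [IsProbabilityMeasure ν]
    (f : ι → ℝ → ℝ≥0∞) (hf : ∀ i, Measurable (f i)) :
    ∫⁻ g, ∏ i, f i (g i) ∂(Measure.pi fun _ : ι => ν) = ∏ i, ∫⁻ x, f i x ∂ν := by
  rw [lintegral_prod_eq_prod_lintegral_of_indepFun Finset.univ (fun i (g : ι → ℝ) => f i (g i))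
    (iIndepFun_pi fun i => (hf i).aemeasurable) (fun i => (hf i).comp (measurable_pi_apply i))]
  refine Finset.prod_congr rfl fun i _ => ?_
  exact (measurePreserving_eval (fun _ : ι => ν) i).lintegral_comp (hf i)

variable {Ω : Type*} [MeasurableSpace Ω] {μ : Measure Ω}

/-- The moment generating function of the random vector `x` is at most twice that of a Gaussian
vector with covariance `s² I`. -/
structure HasVectorMGFBound {ι : Type*} [Fintype ι] (x : Ω → ι → ℝ) (s : ℝ) (μ : Measure Ω) :
    Prop where
  aemeasurable : ∀ i, AEMeasurable (fun ω => x ω i) μ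
  lintegral_exp_le : ∀ a : ι → ℝ, ∫⁻ ω, ENNReal.ofReal (Real.exp (∑ i, x ω i * a i)) ∂μ ≤
    2 * ENNReal.ofReal (Real.exp (s ^ 2 * (∑ i, a i ^ 2) / 2))

/-- Gaussian integration of the moment generating function bounds the exponential moment of the
squared norm. -/
theorem HasVectorMGFBound.lintegral_exp_sq_le {ι : Type*} [Fintype ι] [IsProbabilityMeasure μ]
    {x : Ω → ι → ℝ} {s : ℝ} (h : HasVectorMGFBound x s μ) (hs : 0 < s) :
    ∫⁻ ω, ENNReal.ofReal (Real.exp ((∑ i, x ω i ^ 2) / (4 * s ^ 2))) ∂μ ≤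
      ENNReal.ofReal (2 * √2 ^ Fintype.card ι) := by
  have hmeas := h.aemeasurable
  -- Averaging exp(c⟨x, g⟩) over a standard Gaussian g gives exp(c²‖x‖²/2), the target for this c.
  -- In the other order of integration, the hypothesis at a = c g leaves exp(‖g‖²/4), which is still
  -- integrable.
  set c : ℝ := 1 / (√2 * s) with hc
  have hc2 : c ^ 2 = 1 / (2 * s ^ 2) := by
    rw [hc, div_pow, mul_pow, Real.sq_sqrt (by norm_num), one_pow]
  let γ : Measure (ι → ℝ) := Measure.pi fun _ => gaussianReal 0 1
  have expand : ∀ ω, ENNReal.ofReal (Real.exp ((∑ i, x ω i ^ 2) / (4 * s ^ 2))) =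
      ∫⁻ g, ENNReal.ofReal (Real.exp (∑ i, x ω i * (c * g i))) ∂γ := by
    intro ω
    simp only [Real.exp_sum]
    simp_rw [ENNReal.ofReal_prod_of_nonneg fun i _ => (Real.exp_pos _).le]
    rw [lintegral_pi_prod (gaussianReal 0 1)
      (fun i y => ENNReal.ofReal (Real.exp (x ω i * (c * y)))) (fun i => by fun_prop)]
    simp_rw [← mul_assoc, lintegral_exp_mul_gaussianReal]
    rw [← ENNReal.ofReal_prod_of_nonneg fun i _ => (Real.exp_pos _).le, ← Real.exp_sum,
      Finset.sum_div]
    congr 2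
    refine Finset.sum_congr rfl fun i _ => ?_
    rw [mul_pow, hc2, NNReal.coe_one]
    field_simp
    ring
  simp_rw [expand]
  rw [lintegral_lintegral_swap]
  · calc ∫⁻ g, ∫⁻ ω, ENNReal.ofReal (Real.exp (∑ i, x ω i * (c * g i))) ∂μ ∂γ
        ≤ ∫⁻ g, 2 * ∏ i, ENNReal.ofReal (Real.exp (g i ^ 2 / 4)) ∂γ := by
          refine lintegral_mono fun g => (h.lintegral_exp_le fun i => c * g i).trans_eq ?_
          rw [← ENNReal.ofReal_prod_of_nonneg fun i _ => (Real.exp_pos _).le, ← Real.exp_sum]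
          simp_rw [mul_pow]
          rw [← Finset.mul_sum, hc2, ← Finset.sum_div]
          congr 3
          field_simp
          ring
      _ = ENNReal.ofReal (2 * √2 ^ Fintype.card ι) := by
          rw [lintegral_const_mul _ (by fun_prop),
            lintegral_pi_prod (gaussianReal 0 1)
              (fun _ y => ENNReal.ofReal (Real.exp (y ^ 2 / 4))) (fun _ => by fun_prop)]
          rw [Finset.prod_congr rfl fun _ _ => lintegral_exp_sq_div_four_gaussianReal,
            Finset.prod_const, ENNReal.ofReal_mul (by norm_num), ENNReal.ofReal_pow (by positivity)]
          simp
  · have : AEMeasurable (fun z : Ω × (ι → ℝ) => ∑ i, x z.1 i * (c * z.2 i)) (μ.prod γ) := by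
      refine Finset.aemeasurable_fun_sum _ fun i _ => ?_
      exact ((hmeas i).comp_quasiMeasurePreserving Measure.quasiMeasurePreserving_fst).mul
        (by fun_prop)
    exact (Real.measurable_exp.comp_aemeasurable this).ennreal_ofReal

/-- Finitely many nonnegative exponential moments control a maximum in mean: a function dominating
each `Y j`, whose mean exceeds the logarithm of the total exponential moment by at most one. -/
theorem exists_dominating_of_exp_moment {J : Type*} [Fintype J] {Y : J → Ω → ℝ}
    [IsProbabilityMeasure μ] (hY : ∀ j, AEMeasurable (Y j) μ) {K : ℝ} {N : ℝ} (hN : 1 ≤ N)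
    (hJ : (Fintype.card J : ℝ) ≤ N) (hK : 1 ≤ K)
    (h : ∀ j, ∫⁻ ω, ENNReal.ofReal (Real.exp (Y j ω)) ∂μ ≤ ENNReal.ofReal K) :
    ∃ F : Ω → ℝ, (∀ ω, 0 ≤ F ω) ∧ AEMeasurable F μ ∧ (∀ j ω, Y j ω ≤ F ω) ∧
      ∫⁻ ω, ENNReal.ofReal (F ω) ∂μ ≤ ENNReal.ofReal (Real.log N + Real.log K + 1) := by
  set L := Real.log N + Real.log K with hL
  have hL0 : 0 ≤ L := add_nonneg (Real.log_nonneg hN) (Real.log_nonneg hK)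
  have hexpL : Real.exp L = N * K := by
    rw [hL, Real.exp_add, Real.exp_log (by linarith), Real.exp_log (by linarith)]
  -- Since t ≤ L + exp(t - L), this sum dominates every `Y j`; L = log(N K) makes the mean of the
  -- exponential part at most 1.
  refine ⟨fun ω => L + ∑ j, Real.exp (Y j ω) * Real.exp (-L), fun ω => by positivity,
    ?_, ?_, ?_⟩
  · refine aemeasurable_const.add (Finset.aemeasurable_fun_sum _ fun j _ => ?_)
    exact (Real.measurable_exp.comp_aemeasurable (hY j)).mul_const _
  · intro j ω
    have h1 := Real.add_one_le_exp (Y j ω - L)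
    rw [sub_eq_add_neg, Real.exp_add] at h1
    have h2 := Finset.single_le_sum (f := fun j => Real.exp (Y j ω) * Real.exp (-L))
      (fun i _ => by positivity) (Finset.mem_univ j)
    simp only at h2 ⊢
    linarith
  · simp_rw [ENNReal.ofReal_add hL0 (Finset.sum_nonneg fun j _ => (mul_pos (Real.exp_pos _)
      (Real.exp_pos _)).le), ENNReal.ofReal_sum_of_nonneg fun j _ => (mul_pos (Real.exp_pos _)
      (Real.exp_pos _)).le, ENNReal.ofReal_mul (Real.exp_pos _).le]
    rw [lintegral_add_left measurable_const, lintegral_const, measure_univ, mul_one,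
      lintegral_finsetSum', ENNReal.ofReal_add hL0 zero_le_one]
    swap
    · intro j _
      exact (Real.measurable_exp.comp_aemeasurable (hY j)).ennreal_ofReal.mul_const _
    gcongr
    calc ∑ j, ∫⁻ ω, ENNReal.ofReal (Real.exp (Y j ω)) * ENNReal.ofReal (Real.exp (-L)) ∂μ
        ≤ ∑ _j : J, ENNReal.ofReal K * ENNReal.ofReal (Real.exp (-L)) := by
          refine Finset.sum_le_sum fun j _ => ?_
          rw [lintegral_mul_const' _ _ ENNReal.ofReal_ne_top]
          gcongr
          exact h j
      _ = ENNReal.ofReal (Fintype.card J * (K * Real.exp (-L))) := by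
          rw [Finset.sum_const, Finset.card_univ, nsmul_eq_mul, ENNReal.ofReal_mul (by positivity),
            ENNReal.ofReal_natCast, ENNReal.ofReal_mul (by linarith)]
      _ ≤ ENNReal.ofReal 1 := by
          refine ENNReal.ofReal_le_ofReal ?_
          calc (Fintype.card J : ℝ) * (K * Real.exp (-L)) ≤ N * (K * Real.exp (-L)) := by gcongr
            _ = Real.exp L * Real.exp (-L) := by rw [hexpL]; ring
            _ = 1 := by rw [← Real.exp_add]; simp

end ROCPCA

/-! ### Moment generating functions of the two noise models -/

namespace ROCPCA

variable {Ω : Type*} [MeasurableSpace Ω] {μ : Measure Ω}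

/-- By AM-GM, ξ ≤ ξ²/K² + K²/4, so no centring of ξ is needed; the price is the factor 2. The
infimum only supplies some K < t for each t > s, hence the limit t ↓ s. -/
lemma psi2Norm_mgf_le {ξ : Ω → ℝ} {s : ℝ} (hs : 0 ≤ s)
    (h : psi2Norm ξ μ ≤ ENNReal.ofReal s) :
    ∫⁻ ω, ENNReal.ofReal (Real.exp (ξ ω)) ∂μ ≤ 2 * ENNReal.ofReal (Real.exp (s ^ 2 / 4)) := by
  have step : ∀ t : ℝ, s < t → ∫⁻ ω, ENNReal.ofReal (Real.exp (ξ ω)) ∂μ ≤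
      2 * ENNReal.ofReal (Real.exp (t ^ 2 / 4)) := by
    intro t hst
    have hlt : psi2Norm ξ μ < ENNReal.ofReal t :=
      h.trans_lt ((ENNReal.ofReal_lt_ofReal_iff (hs.trans_lt hst)).2 hst)
    simp only [psi2Norm, iInf_lt_iff] at hlt
    obtain ⟨K, ⟨hK, hKint⟩, hKt⟩ := hlt
    have hKt' : K < t := (ENNReal.ofReal_lt_ofReal_iff (hs.trans_lt hst)).1 hKt
    calc ∫⁻ ω, ENNReal.ofReal (Real.exp (ξ ω)) ∂μ
        ≤ ∫⁻ ω, ENNReal.ofReal (Real.exp (ξ ω ^ 2 / K ^ 2)) *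
            ENNReal.ofReal (Real.exp (t ^ 2 / 4)) ∂μ := by
          refine lintegral_mono fun ω => ?_
          rw [← ENNReal.ofReal_mul (Real.exp_pos _).le, ← Real.exp_add]
          refine ENNReal.ofReal_le_ofReal (Real.exp_le_exp.2 ?_)
          have h1 : K ^ 2 ≤ t ^ 2 := by gcongr
          have h2 : ξ ω = 2 * (ξ ω / K) * (K / 2) := by field_simp
          have h3 := sq_nonneg (ξ ω / K - K / 2)
          rw [← div_pow]
          nlinarith
      _ = (∫⁻ ω, ENNReal.ofReal (Real.exp (ξ ω ^ 2 / K ^ 2)) ∂μ) *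
            ENNReal.ofReal (Real.exp (t ^ 2 / 4)) :=
          lintegral_mul_const' _ _ ENNReal.ofReal_ne_top
      _ ≤ _ := by gcongr
  have hcont : Filter.Tendsto (fun t : ℝ => 2 * ENNReal.ofReal (Real.exp (t ^ 2 / 4)))
      (nhdsWithin s (Set.Ioi s)) (nhds (2 * ENNReal.ofReal (Real.exp (s ^ 2 / 4)))) := by
    refine ENNReal.Tendsto.const_mul ?_ (Or.inr (by norm_num))
    have : Continuous fun t : ℝ => ENNReal.ofReal (Real.exp (t ^ 2 / 4)) :=
      ENNReal.continuous_ofReal.comp (by fun_prop)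
    exact this.continuousAt.tendsto.mono_left nhdsWithin_le_nhds
  exact ge_of_tendsto hcont (Filter.eventually_of_mem self_mem_nhdsWithin step)

lemma HasVectorMGFBound.mono {ι : Type*} [Fintype ι] {x : Ω → ι → ℝ} {s t : ℝ}
    (h : HasVectorMGFBound x s μ) (hs : 0 ≤ s) (hst : s ≤ t) : HasVectorMGFBound x t μ where
  aemeasurable := h.aemeasurable
  lintegral_exp_le a := (h.lintegral_exp_le a).trans (by gcongr)

lemma IsSubGaussianMatrix.hasVectorMGFBound {n p : ℕ} {E : Ω → Matrix (Fin n) (Fin p) ℝ} {σ : ℝ}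
    (hσ : 0 ≤ σ) (h : IsSubGaussianMatrix E σ μ) :
    HasVectorMGFBound (fun ω (ij : Fin n × Fin p) => E ω ij.1 ij.2) σ μ where
  aemeasurable ij := by
    have := (h (Matrix.single ij.1 ij.2 1)).1.1
    refine this.congr (ae_of_all _ fun ω => ?_)
    simp only
    rw [Finset.sum_eq_single ij.1 _ (by simp), Finset.sum_eq_single ij.2 _ (by simp)]
    · simp
    · intro j _ hj
      simp [hj.symm]
    · intro i _ hi
      simp [hi.symm]
  lintegral_exp_le a := by
    have h1 := psi2Norm_mgf_le (by positivity) (h (fun i j => a (i, j))).2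
    have hnn : 0 ≤ ∑ ij, a ij ^ 2 := by positivity
    have h2 : frobSq (fun i j => a (i, j) : Matrix (Fin n) (Fin p) ℝ) = ∑ ij, a ij ^ 2 := by
      simp only [frobSq, Fintype.sum_prod_type]
    rw [h2, mul_pow, Real.sq_sqrt hnn] at h1
    simp only [Fintype.sum_prod_type] at h1 hnn ⊢
    refine h1.trans ?_
    gcongr
    norm_num

lemma IsIIDGaussianMatrix.hasVectorMGFBound {n p : ℕ} {E : Ω → Matrix (Fin n) (Fin p) ℝ} {σ : ℝ}
    (h : IsIIDGaussianMatrix E σ μ) :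
    HasVectorMGFBound (fun ω (ij : Fin n × Fin p) => E ω ij.1 ij.2) σ μ where
  aemeasurable ij := (h.2 ij.1 ij.2).aemeasurable
  lintegral_exp_le a := by
    have : IsProbabilityMeasure μ := h.1.isProbabilityMeasure
    have hm : ∀ ij : Fin n × Fin p, Measurable fun y : ℝ => y * a ij := fun ij => by fun_prop
    have hind : iIndepFun (fun (ij : Fin n × Fin p) ω => E ω ij.1 ij.2 * a ij) μ :=
      h.1.comp (fun ij y => y * a ij) hm
    have hae : ∀ ij : Fin n × Fin p, AEMeasurable (fun ω => E ω ij.1 ij.2) μ :=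
      fun ij => (h.2 ij.1 ij.2).aemeasurable
    have hmgf : ∀ ij : Fin n × Fin p, mgf (fun ω => E ω ij.1 ij.2 * a ij) μ 1 =
        Real.exp (σ ^ 2 * a ij ^ 2 / 2) := by
      intro ij
      have h1 := mgf_gaussianReal (h.2 ij.1 ij.2).map_eq (a ij)
      rw [Real.coe_toNNReal _ (sq_nonneg σ)] at h1
      simp only [mgf, one_mul, zero_mul, zero_add] at h1 ⊢
      simpa only [mul_comm] using h1
    have hsum := hind.mgf_sum₀ (t := 1) (fun ij => (hae ij).mul_const _) Finset.univ
    simp only [hmgf, ← Real.exp_sum] at hsum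
    -- A non-integrable exponential would have `mgf` equal to 0 by convention, so positivity of the
    -- product formula forces integrability.
    have hint : Integrable (fun ω => Real.exp (∑ ij : Fin n × Fin p, E ω ij.1 ij.2 * a ij)) μ := by
      have : 0 < mgf (∑ ij : Fin n × Fin p, fun ω => E ω ij.1 ij.2 * a ij) μ 1 := by
        rw [hsum]; positivity
      simpa [Finset.sum_apply] using (mgf_pos_iff.1 this)
    rw [← ofReal_integral_eq_lintegral_ofReal hint (ae_of_all _ fun _ => (Real.exp_pos _).le)]
    simp only [mgf, one_mul, Finset.sum_apply] at hsum
    rw [hsum, ← Finset.sum_div, ← Finset.mul_sum]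
    exact le_mul_of_one_le_left zero_le one_le_two

/-- Restriction of a sub-Gaussian matrix to a set of rows. -/
lemma HasVectorMGFBound.rows {n p : ℕ} {E : Ω → Matrix (Fin n) (Fin p) ℝ} {s : ℝ}
    (h : HasVectorMGFBound (fun ω (ij : Fin n × Fin p) => E ω ij.1 ij.2) s μ)
    (I : Finset (Fin n)) :
    HasVectorMGFBound (fun ω (ij : I × Fin p) => E ω ij.1 ij.2) s μ where
  aemeasurable ij := h.aemeasurable (ij.1, ij.2)
  lintegral_exp_le a := by
    classical
    set b : Fin n → Fin p → ℝ := fun i j => if hi : i ∈ I then a (⟨i, hi⟩, j) else 0 with hb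
    have hbI : ∀ (i : I) (j : Fin p), b i j = a (i, j) := fun i j => by simp [hb]
    have hbO : ∀ i ∉ I, ∀ j : Fin p, b i j = 0 := fun i hi j => by simp [hb, hi]
    have restrict : ∀ G : Fin n → ℝ, (∀ i ∉ I, G i = 0) → ∑ i, G i = ∑ i : I, G i := by
      intro G hG
      rw [Finset.sum_coe_sort I G]
      exact (Finset.sum_subset (Finset.subset_univ I) fun i _ hi => hG i hi).symm
    have key := h.lintegral_exp_le fun ij => b ij.1 ij.2
    simp only [Fintype.sum_prod_type] at key ⊢
    rw [restrict (fun i => ∑ j, b i j ^ 2) fun i hi => by simp [hbO i hi]] at key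
    have hE : ∀ ω, ∑ i, ∑ j, E ω i j * b i j = ∑ i : I, ∑ j, E ω i j * b i j := fun ω =>
      restrict (fun i => ∑ j, E ω i j * b i j) fun i hi => by simp [hbO i hi]
    simpa only [hE, hbI] using key

/-- Multiplication of a sub-Gaussian matrix with a fixed vector. -/
lemma HasVectorMGFBound.mulVec {n p : ℕ} {E : Ω → Matrix (Fin n) (Fin p) ℝ} {s : ℝ}
    (h : HasVectorMGFBound (fun ω (ij : Fin n × Fin p) => E ω ij.1 ij.2) s μ)
    {w : Fin p → ℝ} {b : ℝ} (hw : ∑ j, w j ^ 2 ≤ b ^ 2) :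
    HasVectorMGFBound (fun ω => (E ω).mulVec w) (b * s) μ where
  aemeasurable i := by
    simp only [Matrix.mulVec, dotProduct]
    exact Finset.aemeasurable_fun_sum _ fun j _ => (h.aemeasurable (i, j)).mul_const _
  lintegral_exp_le a := by
    -- The test matrix is the rank-one a wᵀ, of squared norm ‖a‖²‖w‖².
    have key := h.lintegral_exp_le fun ij => w ij.2 * a ij.1
    simp only [Fintype.sum_prod_type, mul_pow, ← Finset.mul_sum, ← Finset.sum_mul] at key
    simp only [Matrix.mulVec, dotProduct, Finset.sum_mul, mul_assoc]
    refine key.trans ?_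
    have : 0 ≤ ∑ i, a i ^ 2 := by positivity
    rw [mul_pow]
    have : s ^ 2 * ((∑ j, w j ^ 2) * ∑ i, a i ^ 2) ≤ b ^ 2 * s ^ 2 * ∑ i, a i ^ 2 := by
      nlinarith [mul_le_mul_of_nonneg_right hw (mul_nonneg (sq_nonneg s) this)]
    gcongr

end ROCPCA

/-! ### Nets, counting, and uniform bounds on the noise -/

namespace ROCPCA

/-- A `1`-net of the ball of radius `2` with at most `5 ^ dim` points. -/
lemma exists_net (V : Type*) [NormedAddCommGroup V] [NormedSpace ℝ V] [FiniteDimensional ℝ V] :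
    ∃ s : Finset V, s.card ≤ 5 ^ Module.finrank ℝ V ∧ (∀ c ∈ s, ‖c‖ ≤ 2) ∧
      ∀ x : V, ‖x‖ ≤ 2 → ∃ c ∈ s, ‖x - c‖ ≤ 1 := by
  classical
  -- Sizes of 1-separated subsets of the ball, bounded by volume comparison; a separated set of
  -- maximal size is a net.
  set S : Set ℕ := {k | ∃ s : Finset V, (∀ c ∈ s, ‖c‖ ≤ 2) ∧
    (∀ c ∈ s, ∀ d ∈ s, c ≠ d → 1 ≤ ‖c - d‖) ∧ s.card = k} with hS
  have hne : S.Nonempty := ⟨0, ∅, by simp⟩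
  have hbdd : BddAbove S := by
    refine ⟨5 ^ Module.finrank ℝ V, ?_⟩
    rintro _ ⟨s, h1, h2, rfl⟩
    exact Besicovitch.card_le_of_separated s h1 h2
  obtain ⟨s, h1, h2, h3⟩ := Nat.sSup_mem hne hbdd
  refine ⟨s, Besicovitch.card_le_of_separated s h1 h2, h1, fun x hx => ?_⟩
  by_contra! hfar
  have hxs : x ∉ s := fun hxs => by
    have := hfar x hxs
    simp at this
    linarith
  have hmem : s.card + 1 ∈ S := by
    refine ⟨insert x s, ?_, ?_, Finset.card_insert_of_notMem hxs⟩
    · intro c hc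
      rcases Finset.mem_insert.1 hc with rfl | hc
      exacts [hx, h1 c hc]
    · intro c hc d hd hcd
      rcases Finset.mem_insert.1 hc with rfl | hc' <;> rcases Finset.mem_insert.1 hd with rfl | hd'
      · exact absurd rfl hcd
      · exact (hfar d hd').le
      · rw [norm_sub_rev]
        exact (hfar c hc').le
      · exact h2 c hc' d hd' hcd
  have := le_csSup hbdd hmem
  omega

/-- For a unit x, approximating 2x within 1 gives 2‖Tx‖ ≤ M + ‖T‖. The factor lost to the net is
thus paid by letting its points have norm up to 2. -/
lemma opNorm_le_of_net {V W : Type*} [NormedAddCommGroup V] [NormedSpace ℝ V]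
    [NormedAddCommGroup W] [NormedSpace ℝ W] {s : Finset V}
    (hs : ∀ x : V, ‖x‖ ≤ 2 → ∃ c ∈ s, ‖x - c‖ ≤ 1) (T : V →L[ℝ] W) {M : ℝ} (hM : 0 ≤ M)
    (h : ∀ c ∈ s, ‖T c‖ ≤ M) : ‖T‖ ≤ M := by
  have key : ‖T‖ ≤ (M + ‖T‖) / 2 := by
    refine T.opNorm_le_of_unit_norm (by positivity) fun x hx => ?_
    obtain ⟨c, hc, hxc⟩ := hs ((2 : ℝ) • x) (by simp [norm_smul, hx])
    have h1 : ‖T ((2 : ℝ) • x)‖ ≤ ‖T c‖ + ‖T ((2 : ℝ) • x - c)‖ := by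
      rw [map_sub]
      exact norm_le_norm_add_norm_sub' _ _
    have h2 : ‖T ((2 : ℝ) • x - c)‖ ≤ ‖T‖ * 1 := T.le_opNorm_of_le hxc
    rw [map_smul, norm_smul, Real.norm_ofNat] at h1
    linarith [h c hc]
  linarith

/-- Combines C(n, q) ≤ n^q / q! with q^q / q! ≤ e^q. At q = 0 both sides are 1. -/
lemma choose_le_exp_mul_log (n q : ℕ) (hq : q ≤ n) :
    (n.choose q : ℝ) ≤ Real.exp (q * Real.log (Real.exp 1 * n / q)) := by
  rcases Nat.eq_zero_or_pos q with rfl | hq0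
  · simp
  have hq0' : (0 : ℝ) < q := by exact_mod_cast hq0
  have hn0 : (0 : ℝ) < n := by exact_mod_cast hq0.trans_le hq
  have hfac : (0 : ℝ) < (q.factorial : ℝ) := by exact_mod_cast q.factorial_pos
  have h1 := Nat.choose_le_pow_div (α := ℝ) q n
  have h2 := Real.pow_div_factorial_le_exp _ hq0'.le q
  rw [Real.exp_nat_mul, Real.exp_log (by positivity), div_pow, mul_pow, ← Real.exp_nat_mul, mul_one]
  refine h1.trans ?_
  rw [div_le_iff₀ hfac] at h2 ⊢
  rw [div_mul_eq_mul_div, le_div_iff₀ (by positivity)]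
  nlinarith [mul_le_mul_of_nonneg_left h2 (pow_nonneg hn0.le q)]

lemma zero_le_mul_log (n q : ℕ) (hq : q ≤ n) :
    0 ≤ (q : ℝ) * Real.log (Real.exp 1 * n / q) := by
  have h1 := choose_le_exp_mul_log n q hq
  have h2 : (1 : ℝ) ≤ n.choose q := by exact_mod_cast Nat.choose_pos hq
  simpa using h2.trans h1

lemma log_two_mul_sqrt_two_pow_le (k : ℕ) : Real.log (2 * √2 ^ k) ≤ 1 + k := by
  have h2 : Real.log 2 ≤ 1 := by linarith [Real.log_two_lt_d9]
  rw [Real.log_mul (by norm_num) (by positivity), Real.log_pow, Real.log_sqrt (by norm_num)]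
  have : (k : ℝ) * (Real.log 2 / 2) ≤ k * 1 := by gcongr; linarith
  linarith

lemma one_le_two_mul_sqrt_two_pow (k : ℕ) : 1 ≤ 2 * √2 ^ k := by
  have : 1 ≤ √2 ^ k := one_le_pow₀ (Real.one_le_sqrt.2 (by norm_num))
  linarith

variable {Ω : Type*} [MeasurableSpace Ω] {μ : Measure Ω} [IsProbabilityMeasure μ]
  {n p : ℕ} {E : Ω → Matrix (Fin n) (Fin p) ℝ} {s : ℝ}

/-- Uniform control of the squared norms of all submatrices of at most `q` rows. -/
theorem HasVectorMGFBound.exists_rows_bound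
    (h : HasVectorMGFBound (fun ω (ij : Fin n × Fin p) => E ω ij.1 ij.2) s μ) (hs : 0 < s)
    {q : ℕ} (hq : q ≤ n) :
    ∃ F : Ω → ℝ, (∀ ω, 0 ≤ F ω) ∧ AEMeasurable F μ ∧
      (∀ ω, ∀ I : Finset (Fin n), I.card ≤ q → ∑ i ∈ I, ∑ j, E ω i j ^ 2 ≤ 4 * s ^ 2 * F ω) ∧
      ∫⁻ ω, ENNReal.ofReal (F ω) ∂μ ≤
        ENNReal.ofReal (q * Real.log (Real.exp 1 * n / q) + q * p + 2) := by
  -- The union runs over sets of exactly q rows: their number contributes q log(en/q), and each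
  -- qp-dimensional moment contributes qp.
  obtain ⟨F, hF0, hFm, hF, hFint⟩ := exists_dominating_of_exp_moment (μ := μ)
    (J := {I : Finset (Fin n) // I.card = q})
    (Y := fun I ω => (∑ ij : I.1 × Fin p, E ω ij.1 ij.2 ^ 2) / (4 * s ^ 2))
    (K := 2 * √2 ^ (q * p)) (N := Real.exp (q * Real.log (Real.exp 1 * n / q)))
    (fun I => (Finset.aemeasurable_fun_sum _ fun ij _ =>
      ((h.rows I.1).aemeasurable ij).pow_const 2).div_const _)
    (Real.one_le_exp (zero_le_mul_log n q hq))
    (by rw [Fintype.card_finset_len, Fintype.card_fin]; exact choose_le_exp_mul_log n q hq)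
    (one_le_two_mul_sqrt_two_pow _)
    (fun I => by
      have := (h.rows I.1).lintegral_exp_sq_le hs
      rwa [Fintype.card_prod, Fintype.card_coe, I.2, Fintype.card_fin] at this)
  refine ⟨F, hF0, hFm, fun ω I hI => ?_, hFint.trans (ENNReal.ofReal_le_ofReal ?_)⟩
  · obtain ⟨I', hII', -, hI'⟩ := Finset.exists_subsuperset_card_eq (Finset.subset_univ I) hI
      (by simpa using hq)
    have h1 := hF ⟨I', hI'⟩ ω
    simp only at h1
    rw [div_le_iff₀' (by positivity), Fintype.sum_prod_type,
      Finset.sum_coe_sort I' fun i => ∑ j, E ω i j ^ 2] at h1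
    exact (Finset.sum_le_sum_of_subset_of_nonneg hII' fun i _ _ => by positivity).trans h1
  · have := log_two_mul_sqrt_two_pow_le (q * p)
    rw [Real.log_exp]
    push_cast at this
    linarith

/-- Control of the squared operator norm. -/
theorem HasVectorMGFBound.exists_opNorm_bound
    (h : HasVectorMGFBound (fun ω (ij : Fin n × Fin p) => E ω ij.1 ij.2) s μ) (hs : 0 < s) :
    ∃ H : Ω → ℝ, (∀ ω, 0 ≤ H ω) ∧ AEMeasurable H μ ∧
      (∀ ω, ∀ u : EuclideanSpace ℝ (Fin p), ‖u‖ ≤ 1 →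
        ∑ i, (E ω).mulVec u i ^ 2 ≤ 16 * s ^ 2 * H ω) ∧
      ∫⁻ ω, ENNReal.ofReal (H ω) ∂μ ≤ ENNReal.ofReal (2 * p + n + 2) := by
  obtain ⟨N, hNcard, hN2, hNnet⟩ := exists_net (EuclideanSpace ℝ (Fin p))
  have hmv : ∀ w : N, HasVectorMGFBound (fun ω => (E ω).mulVec w.1) (2 * s) μ := fun w =>
    h.mulVec (by
      rw [← EuclideanSpace.real_norm_sq_eq]
      have := hN2 w.1 w.2
      gcongr)
  -- Makes the logarithm of the net's cardinality at most 2p.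
  have hlog5 : (5 : ℝ) ≤ Real.exp 2 := by
    have := Real.exp_one_gt_d9
    rw [show (2 : ℝ) = 1 + 1 by norm_num, Real.exp_add]
    nlinarith
  obtain ⟨H, hH0, hHm, hH, hHint⟩ := exists_dominating_of_exp_moment (μ := μ) (J := N)
    (Y := fun w ω => (∑ i, (E ω).mulVec w.1 i ^ 2) / (4 * (2 * s) ^ 2))
    (K := 2 * √2 ^ n) (N := Real.exp (p * 2))
    (fun w => (Finset.aemeasurable_fun_sum _ fun i _ =>
      ((hmv w).aemeasurable i).pow_const 2).div_const _)
    (Real.one_le_exp (by positivity))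
    (by
      rw [Fintype.card_coe, Real.exp_nat_mul]
      rw [finrank_euclideanSpace_fin] at hNcard
      calc (N.card : ℝ) ≤ 5 ^ p := by exact_mod_cast hNcard
        _ ≤ Real.exp 2 ^ p := by gcongr)
    (one_le_two_mul_sqrt_two_pow _)
    (fun w => by
      have := (hmv w).lintegral_exp_sq_le (by positivity)
      rwa [Fintype.card_fin] at this)
  refine ⟨H, hH0, hHm, fun ω u hu => ?_, hHint.trans (ENNReal.ofReal_le_ofReal ?_)⟩
  · set T : EuclideanSpace ℝ (Fin p) →L[ℝ] EuclideanSpace ℝ (Fin n) :=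
      (Matrix.toEuclideanLin (E ω)).toContinuousLinearMap with hT
    have hTsq : ∀ v, ‖T v‖ ^ 2 = ∑ i, (E ω).mulVec v i ^ 2 := fun v => by
      rw [EuclideanSpace.real_norm_sq_eq]
      rfl
    have hnn : 0 ≤ 16 * s ^ 2 * H ω := mul_nonneg (by positivity) (hH0 ω)
    have hTn : ‖T‖ ≤ √(16 * s ^ 2 * H ω) := by
      refine opNorm_le_of_net hNnet T (Real.sqrt_nonneg _) fun c hc => ?_
      refine Real.le_sqrt_of_sq_le ?_
      have h1 := hH ⟨c, hc⟩ ω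
      simp only at h1
      rw [div_le_iff₀' (by positivity)] at h1
      rw [hTsq]
      exact h1.trans_eq (by ring)
    rw [← hTsq]
    calc ‖T u‖ ^ 2 ≤ (√(16 * s ^ 2 * H ω)) ^ 2 := by
          gcongr
          exact (T.le_of_opNorm_le_of_le hTn hu).trans_eq (mul_one _)
      _ = _ := Real.sq_sqrt hnn
  · have := log_two_mul_sqrt_two_pow_le n
    rw [Real.log_exp]
    linarith

/-- Pairing of a noise matrix with a matrix whose rows outside `J` lie in the subspace `W`. -/
theorem two_mul_inner_le (E D : Matrix (Fin n) (Fin p) ℝ) (J : Finset (Fin n))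
    (W : Submodule ℝ (EuclideanSpace ℝ (Fin p)))
    (hD : ∀ i ∉ J, (WithLp.toLp 2 (D i) : EuclideanSpace ℝ (Fin p)) ∈ W) {H : ℝ}
    (hH : ∀ u : EuclideanSpace ℝ (Fin p), ‖u‖ ≤ 1 → ∑ i, E.mulVec u i ^ 2 ≤ H) :
    2 * ∑ i, ∑ j, E i j * D i j ≤
      4 * (∑ i ∈ J, ∑ j, E i j ^ 2 + Module.finrank ℝ W * H) + frobSq D / 4 := by
  classical
  let e : Fin n → EuclideanSpace ℝ (Fin p) := fun i => WithLp.toLp 2 (E i)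
  let d : Fin n → EuclideanSpace ℝ (Fin p) := fun i => WithLp.toLp 2 (D i)
  have he : ∀ i, ‖e i‖ ^ 2 = ∑ j, E i j ^ 2 := fun i => EuclideanSpace.real_norm_sq_eq _
  have hd : ∀ i, ‖d i‖ ^ 2 = ∑ j, D i j ^ 2 := fun i => EuclideanSpace.real_norm_sq_eq _
  have hinner : ∀ i, inner ℝ (e i) (d i) = ∑ j, E i j * D i j := fun i => by
    simp [e, d, PiLp.inner_apply, mul_comm]
  -- The weight 1/4 is small enough for ‖D‖² to be absorbed after D is split into two errors.
  have cs : ∀ x y : EuclideanSpace ℝ (Fin p), 2 * inner ℝ x y ≤ 4 * ‖x‖ ^ 2 + ‖y‖ ^ 2 / 4 := by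
    intro x y
    have := real_inner_le_norm x y
    nlinarith [sq_nonneg (2 * ‖x‖ - ‖y‖ / 2)]
  -- In an orthonormal basis b of W the sum equals Σ_k ‖E b_k‖², with each term at most H.
  have hproj : ∑ i, ‖W.orthogonalProjectionOnto (e i)‖ ^ 2 ≤ Module.finrank ℝ W * H := by
    let b := stdOrthonormalBasis ℝ W
    have h1 : ∀ i, ‖W.orthogonalProjectionOnto (e i)‖ ^ 2 =
        ∑ k, E.mulVec (b k : EuclideanSpace ℝ (Fin p)) i ^ 2 := by
      intro i
      rw [← b.sum_sq_norm_inner_right]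
      refine Finset.sum_congr rfl fun k _ => ?_
      rw [Submodule.inner_orthogonalProjectionOnto_eq_of_mem_left, Real.norm_eq_abs, sq_abs]
      simp [e, PiLp.inner_apply, Matrix.mulVec, dotProduct]
    simp_rw [h1]
    rw [Finset.sum_comm]
    calc _ ≤ ∑ _k : Fin (Module.finrank ℝ W), H :=
          Finset.sum_le_sum fun k _ => hH _ (by
            have := b.orthonormal.1 k
            exact (Submodule.coe_norm (b k)).symm.trans this |>.le)
      _ = _ := by simp
  have hrow : ∀ i, 2 * ∑ j, E i j * D i j ≤
      4 * ((if i ∈ J then ∑ j, E i j ^ 2 else 0) + ‖W.orthogonalProjectionOnto (e i)‖ ^ 2) +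
        (∑ j, D i j ^ 2) / 4 := by
    intro i
    rw [← hinner, ← hd, ← he]
    split_ifs with hi
    · have := cs (e i) (d i)
      have h0 : 0 ≤ ‖W.orthogonalProjectionOnto (e i)‖ ^ 2 := by positivity
      linarith
    · have h1 : inner ℝ (e i) (d i) =
          inner ℝ (W.orthogonalProjectionOnto (e i) : EuclideanSpace ℝ (Fin p)) (d i) :=
        (Submodule.inner_orthogonalProjectionOnto_eq_of_mem_right (⟨d i, hD i hi⟩ : W) (e i)).symm
      have := cs (W.orthogonalProjectionOnto (e i) : EuclideanSpace ℝ (Fin p)) (d i)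
      rw [h1, zero_add]
      exact this
  rw [Finset.mul_sum]
  refine (Finset.sum_le_sum fun i _ => hrow i).trans ?_
  rw [Finset.sum_add_distrib, ← Finset.mul_sum, Finset.sum_add_distrib, ← Finset.sum_div,
    Finset.sum_ite_mem, Finset.univ_inter]
  simp only [frobSq]
  gcongr

end ROCPCA

/-! ### The oracle inequality for fixed noise -/

namespace ROCPCA

section Deterministic

variable {n p r q : ℕ}

/-- The set of nonzero rows. -/
noncomputable def rowSupport {d : ℕ} (S : Matrix (Fin n) (Fin d) ℝ) : Finset (Fin n) :=
  {i : Fin n | ∃ j, S i j ≠ 0}.toFinite.toFinset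

lemma card_rowSupport {d : ℕ} (S : Matrix (Fin n) (Fin d) ℝ) : (rowSupport S).card = rowL0 S :=
  (Set.ncard_eq_toFinset_card _).symm

/-- The span of the columns of `V`. -/
def colSpace (V : Matrix (Fin p) (Fin r) ℝ) : Submodule ℝ (EuclideanSpace ℝ (Fin p)) :=
  Submodule.span ℝ (Set.range fun k => WithLp.toLp 2 (V.transpose k))

lemma finrank_colSpace_le (V : Matrix (Fin p) (Fin r) ℝ) :
    Module.finrank ℝ (colSpace V) ≤ r := by
  have := finrank_range_le_card (R := ℝ)
    (fun k => (WithLp.toLp 2 (V.transpose k) : EuclideanSpace ℝ (Fin p)))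
  rwa [Fintype.card_fin] at this

/-- Off the outlying rows only A Vᵀ survives, so such a row is a combination of the r columns of V.
-/
lemma Param.signal_row_mem (θ : Param n p r) {i : Fin n} (hi : i ∉ rowSupport θ.S) :
    (WithLp.toLp 2 (θ.signal i) : EuclideanSpace ℝ (Fin p)) ∈ colSpace θ.V := by
  have hS : ∀ j, θ.S i j = 0 := by simpa [rowSupport] using hi
  have : (WithLp.toLp 2 (θ.signal i) : EuclideanSpace ℝ (Fin p)) =
      ∑ k, θ.A i k • (WithLp.toLp 2 (θ.V.transpose k) : EuclideanSpace ℝ (Fin p)) := by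
    ext j
    simp [Param.signal, Matrix.mul_apply, hS]
  rw [this]
  exact Submodule.sum_mem _ fun k _ =>
    Submodule.smul_mem _ _ (Submodule.subset_span (Set.mem_range_self k))

lemma frobSq_nonneg (M : Matrix (Fin n) (Fin p) ℝ) : 0 ≤ frobSq M := by
  unfold frobSq
  positivity

lemma frobSq_sub (M N : Matrix (Fin n) (Fin p) ℝ) :
    frobSq (M - N) = frobSq M - 2 * ∑ i, ∑ j, M i j * N i j + frobSq N := by
  simp only [frobSq, Finset.mul_sum, ← Finset.sum_sub_distrib, ← Finset.sum_add_distrib,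
    Matrix.sub_apply]
  refine Finset.sum_congr rfl fun i _ => Finset.sum_congr rfl fun j _ => ?_
  ring

lemma frobSq_sub_le (M N : Matrix (Fin n) (Fin p) ℝ) :
    frobSq (M - N) ≤ 2 * frobSq M + 2 * frobSq N := by
  simp only [frobSq, Finset.mul_sum, ← Finset.sum_add_distrib, Matrix.sub_apply]
  refine Finset.sum_le_sum fun i _ => Finset.sum_le_sum fun j _ => ?_
  nlinarith [sq_nonneg (M i j + N i j)]

/-- Oracle inequality for a fixed noise matrix `E`, in terms of its squared row norms and of its
squared operator norm. -/
theorem Param.IsGlobalOpt.frobSq_le {E : Matrix (Fin n) (Fin p) ℝ} {θhat θ θstar : Param n p r}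
    (hopt : θhat.IsGlobalOpt q (θstar.signal + E)) (hθ : θ.Feasible q) {F H : ℝ}
    (hF : ∀ I : Finset (Fin n), I.card ≤ q → ∑ i ∈ I, ∑ j, E i j ^ 2 ≤ F)
    (hH0 : 0 ≤ H)
    (hH : ∀ u : EuclideanSpace ℝ (Fin p), ‖u‖ ≤ 1 → ∑ i, E.mulVec u i ^ 2 ≤ H) :
    frobSq (θhat.signal - θstar.signal) ≤
      3 * frobSq (θ.signal - θstar.signal) + 16 * (F + r * H) := by
  classical
  set x := θhat.signal - θstar.signal with hx
  set y := θ.signal - θstar.signal with hy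
  have hxy : θhat.signal - θ.signal = x - y := by rw [hx, hy]; abel
  have hbasic : frobSq (E - x) ≤ frobSq (E - y) := by
    have h := hopt.2 θ hθ
    have h1 : ∀ η : Param n p r, θstar.signal + E - η.A * η.V.transpose -
        η.S * η.Vperp.transpose = E - (η.signal - θstar.signal) := fun η => by
      have h2 : η.signal = η.A * η.V.transpose + η.S * η.Vperp.transpose := rfl
      rw [h2]; abel
    rwa [h1, h1] at h
  have hpair := two_mul_inner_le E (x - y) (rowSupport θhat.S ∪ rowSupport θ.S)
    (colSpace θhat.V ⊔ colSpace θ.V) (fun i hi => by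
      rw [Finset.mem_union, not_or] at hi
      rw [← hxy]
      exact Submodule.sub_mem _ (Submodule.mem_sup_left (θhat.signal_row_mem hi.1))
        (Submodule.mem_sup_right (θ.signal_row_mem hi.2))) hH
  have hrank : (Module.finrank ℝ ↥(colSpace θhat.V ⊔ colSpace θ.V) : ℝ) ≤ r + r := by
    exact_mod_cast (Submodule.finrank_add_le_finrank_add_finrank _ _).trans
      (add_le_add (finrank_colSpace_le _) (finrank_colSpace_le _))
  have hrows : ∑ i ∈ rowSupport θhat.S ∪ rowSupport θ.S, ∑ j, E i j ^ 2 ≤ F + F := by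
    refine le_trans ?_ (add_le_add (hF (rowSupport θhat.S) ((card_rowSupport _).trans_le hopt.1.1))
      (hF (rowSupport θ.S) ((card_rowSupport _).trans_le hθ.1)))
    rw [← Finset.sum_union_inter]
    exact le_add_of_nonneg_right (by positivity)
  have hlin : ∑ i, ∑ j, E i j * (x - y) i j =
      (∑ i, ∑ j, E i j * x i j) - ∑ i, ∑ j, E i j * y i j := by
    simp only [Matrix.sub_apply, mul_sub, Finset.sum_sub_distrib]
  -- Now ‖x‖² ≤ ‖y‖² + 8(F + rH) + ‖x - y‖²/4 and ‖x - y‖² ≤ 2‖x‖² + 2‖y‖². Half of ‖x‖² moves to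
  -- the left, and doubling gives the constants 3 and 16.
  rw [frobSq_sub E x, frobSq_sub E y] at hbasic
  have := mul_le_mul_of_nonneg_right hrank hH0
  have := frobSq_sub_le x y
  linarith

end Deterministic

/-! ### Risk bounds in expectation and the breakdown point -/

variable {Ω : Type*} [MeasurableSpace Ω] {μ : Measure Ω} [IsProbabilityMeasure μ]
  {n p r q : ℕ} {E : Ω → Matrix (Fin n) (Fin p) ℝ} {s : ℝ}

lemma Param.meanError_nonneg (θ θstar : Param n p r) : 0 ≤ θ.meanError θstar :=
  mul_nonneg (by positivity) (frobSq_nonneg _)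

/-- `F` and `H` control all row sets and directions simultaneously, so the fixed-noise inequality
applies to a random `θhat`. Only `F` and `H` have to be measurable, since `lintegral` is monotone
without measurability. -/
theorem HasVectorMGFBound.oracle
    (h : HasVectorMGFBound (fun ω (ij : Fin n × Fin p) => E ω ij.1 ij.2) s μ) (hs : 0 < s)
    (hn : 0 < n) (hp : 0 < p) (hq : q ≤ n) {θstar : Param n p r} {θhat : Ω → Param n p r}
    (hopt : ∀ᵐ ω ∂μ, (θhat ω).IsGlobalOpt q (θstar.signal + E ω)) {θ : Param n p r}
    (hθ : θ.Feasible q) :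
    ∫⁻ ω, ENNReal.ofReal ((θhat ω).meanError θstar) ∂μ ≤ ENNReal.ofReal
      (1024 * (θ.meanError θstar + rate q r n p s + s ^ 2 / ((n : ℝ) * p))) := by
  obtain ⟨F, hF0, hFm, hF, hFint⟩ := h.exists_rows_bound hs hq
  obtain ⟨H, hH0, hHm, hH, hHint⟩ := h.exists_opNorm_bound hs
  have hn' : (1 : ℝ) ≤ n := by exact_mod_cast hn
  have hp' : (1 : ℝ) ≤ p := by exact_mod_cast hp
  have hnp : (0 : ℝ) < (n : ℝ) * p := by positivity
  -- 64 = 16 · 4 and 256 = 16 · 16: the factor 16 of the fixed-noise inequality times the scales 4s²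
  -- and 16s² of the two noise bounds.
  set a : ℝ := 64 * s ^ 2 / ((n : ℝ) * p) with ha
  set b : ℝ := 256 * s ^ 2 * r / ((n : ℝ) * p) with hb
  have ha0 : 0 ≤ a := by positivity
  have hb0 : 0 ≤ b := by positivity
  have hM0 := θ.meanError_nonneg θstar
  have hl0 := zero_le_mul_log n q hq
  have hpoint : ∀ᵐ ω ∂μ, ENNReal.ofReal ((θhat ω).meanError θstar) ≤
      ENNReal.ofReal (3 * θ.meanError θstar) + ENNReal.ofReal a * ENNReal.ofReal (F ω) +
        ENNReal.ofReal b * ENNReal.ofReal (H ω) := by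
    filter_upwards [hopt] with ω hω
    rw [← ENNReal.ofReal_mul ha0, ← ENNReal.ofReal_mul hb0, ← ENNReal.ofReal_add (by positivity)
      (mul_nonneg ha0 (hF0 ω)), ← ENNReal.ofReal_add (add_nonneg (by positivity)
      (mul_nonneg ha0 (hF0 ω))) (mul_nonneg hb0 (hH0 ω))]
    refine ENNReal.ofReal_le_ofReal ?_
    have h1 := hω.frobSq_le hθ (hF ω) (mul_nonneg (by positivity) (hH0 ω)) (hH ω)
    have h2 := mul_le_mul_of_nonneg_left h1 (one_div_pos.2 hnp).le
    refine h2.trans_eq ?_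
    rw [Param.meanError, ha, hb]
    field_simp
    ring
  calc ∫⁻ ω, ENNReal.ofReal ((θhat ω).meanError θstar) ∂μ
      ≤ ∫⁻ ω, ENNReal.ofReal (3 * θ.meanError θstar) + ENNReal.ofReal a * ENNReal.ofReal (F ω) +
        ENNReal.ofReal b * ENNReal.ofReal (H ω) ∂μ := lintegral_mono_ae hpoint
    _ = ENNReal.ofReal (3 * θ.meanError θstar) +
          ENNReal.ofReal a * ∫⁻ ω, ENNReal.ofReal (F ω) ∂μ +
          ENNReal.ofReal b * ∫⁻ ω, ENNReal.ofReal (H ω) ∂μ := by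
        rw [lintegral_add_right' _ (hHm.ennreal_ofReal.const_mul _),
          lintegral_add_left measurable_const, lintegral_const, measure_univ, mul_one,
          lintegral_const_mul' _ _ ENNReal.ofReal_ne_top,
          lintegral_const_mul' _ _ ENNReal.ofReal_ne_top]
    _ ≤ ENNReal.ofReal (3 * θ.meanError θstar) +
          ENNReal.ofReal a *
            ENNReal.ofReal (q * Real.log (Real.exp 1 * n / q) + q * p + 2) +
          ENNReal.ofReal b * ENNReal.ofReal (2 * p + n + 2) := by gcongr
    _ = ENNReal.ofReal (3 * θ.meanError θstar +
          a * (q * Real.log (Real.exp 1 * n / q) + q * p + 2) + b * (2 * p + n + 2)) := by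
        rw [← ENNReal.ofReal_mul ha0, ← ENNReal.ofReal_mul hb0, ← ENNReal.ofReal_add,
          ← ENNReal.ofReal_add] <;> positivity
    _ ≤ _ := by
        refine ENNReal.ofReal_le_ofReal ?_
        set l := (q : ℝ) * Real.log (Real.exp 1 * n / q)
        -- The rp term fixes 1024 = 512 + 512, the second half coming from r ≤ rp.
        have hnum : 64 * (l + q * p + 2) + 256 * r * (2 * p + n + 2) ≤
            1024 * ((q : ℝ) * p + r * n + r * p + l) + 1024 := by
          have hr0 : (0 : ℝ) ≤ r := by positivity
          have hqp : (0 : ℝ) ≤ q * p := by positivity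
          have hrn : (0 : ℝ) ≤ r * n := by positivity
          nlinarith [mul_le_mul_of_nonneg_left hp' hr0]
        have h3 := mul_le_mul_of_nonneg_left hnum (show 0 ≤ s ^ 2 / ((n : ℝ) * p) by positivity)
        have h4 : a * (l + q * p + 2) + b * (2 * p + n + 2) = s ^ 2 / ((n : ℝ) * p) *
            (64 * (l + q * p + 2) + 256 * r * (2 * p + n + 2)) := by rw [ha, hb]; ring
        have h5 : 1024 * (rate q r n p s + s ^ 2 / ((n : ℝ) * p)) = s ^ 2 / ((n : ℝ) * p) *
            (1024 * ((q : ℝ) * p + r * n + r * p + l) + 1024) := by rw [rate]; ring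
        linarith

/-- The oracle inequality for both noise models, with an explicit constant. -/
theorem oracle_inequality (hn : 0 < n) (hp : 0 < p) (hq : q ≤ n) {σ : ℝ} (hσ : 0 ≤ σ)
    (hE : IsIIDGaussianMatrix E σ μ ∨ IsSubGaussianMatrix E σ μ) {θstar : Param n p r}
    {θhat : Ω → Param n p r} (hopt : ∀ᵐ ω ∂μ, (θhat ω).IsGlobalOpt q (θstar.signal + E ω))
    {θ : Param n p r} (hθ : θ.Feasible q) :
    ∫⁻ ω, ENNReal.ofReal ((θhat ω).meanError θstar) ∂μ ≤ ENNReal.ofReal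
      (1024 * (θ.meanError θstar + rate q r n p σ + σ ^ 2 / ((n : ℝ) * p))) := by
  have hmgf := hE.elim (fun h => h.hasVectorMGFBound) fun h => h.hasVectorMGFBound hσ
  -- The bound is proved for every s > σ and passed to the limit s ↓ σ; this covers σ = 0, where
  -- dividing by σ² would fail.
  have hcont : Continuous fun s : ℝ => ENNReal.ofReal
      (1024 * (θ.meanError θstar + rate q r n p s + s ^ 2 / ((n : ℝ) * p))) := by
    unfold rate
    exact ENNReal.continuous_ofReal.comp (by fun_prop)
  refine ge_of_tendsto (hcont.continuousAt.tendsto.mono_left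
    (nhdsWithin_le_nhds (s := Set.Ioi σ))) (Filter.eventually_of_mem self_mem_nhdsWithin ?_)
  intro s hs
  exact (hmgf.mono hσ (le_of_lt hs)).oracle (hσ.trans_lt hs) hn hp hq hopt hθ

theorem worstRisk_ne_top (hn : 0 < n) (hp : 0 < p) (hq : q ≤ n) {σ : ℝ} (hσ : 0 ≤ σ)
    {est : Matrix (Fin n) (Fin p) ℝ → Param n p r} (hest : ∀ X, (est X).IsGlobalOpt q X)
    {k : ℕ} (hk : k ≤ q) : worstRisk est σ k ≠ ⊤ := by
  refine ne_top_of_le_ne_top (ENNReal.ofReal_ne_top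
    (r := 1024 * (rate q r n p σ + σ ^ 2 / ((n : ℝ) * p)))) ?_
  refine iSup_le fun B => iSup_le fun hB => iSup_le fun ν => iSup_le fun _ => iSup_le fun hν => ?_
  have := oracle_inequality hn hp hq hσ (Or.inr hν) (θstar := B)
    (θhat := fun E => est (B.signal + E)) (ae_of_all _ fun E => hest _)
    (θ := B) ⟨hB.1.trans hk, hB.2⟩
  have hself : B.meanError B = 0 := by simp [Param.meanError, frobSq]
  rwa [hself, zero_add] at this

theorem le_breakdownPoint (hn : 0 < n) (hp : 0 < p) (hq : q ≤ n) {σ : ℝ} (hσ : 0 ≤ σ)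
    {est : Matrix (Fin n) (Fin p) ℝ → Param n p r} (hest : ∀ X, (est X).IsGlobalOpt q X) :
    ((q : ℝ≥0∞) + 1) / n ≤ breakdownPoint est σ := by
  refine ENNReal.div_le_div_right (le_iInf fun k => le_iInf fun hk => ?_) _
  have : q < k := not_le.1 fun hkq => worstRisk_ne_top hn hp hq hσ hest hkq hk
  exact_mod_cast this

end ROCPCA

theorem theorem2 :
    -- the oracle inequality, with a numerical constant
    (∃ C : ℝ, 0 < C ∧
      ∀ (n p r q : ℕ), 0 < n → 0 < p → r ≤ p → q ≤ n →
      ∀ (σ : ℝ), 0 ≤ σ →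
      ∀ (Ω : Type*) [MeasurableSpace Ω] (μ : Measure Ω) [IsProbabilityMeasure μ]
        (E : Ω → Matrix (Fin n) (Fin p) ℝ),
        (IsIIDGaussianMatrix E σ μ ∨ IsSubGaussianMatrix E σ μ) →
      ∀ θstar : Param n p r, θstar.IsOrthogonal →
      ∀ θhat : Ω → Param n p r,
        (∀ᵐ ω ∂μ, (θhat ω).IsGlobalOpt q (θstar.signal + E ω)) →
      ∀ θ : Param n p r, θ.Feasible q →
        ∫⁻ ω, ENNReal.ofReal ((θhat ω).meanError θstar) ∂μ ≤
          ENNReal.ofReal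
            (C * (θ.meanError θstar + rate q r n p σ + σ ^ 2 / ((n : ℝ) * p)))) ∧
    -- the finite-sample breakdown point
    (∀ (n p r q : ℕ), 0 < n → 0 < p → r ≤ p → q ≤ n →
      ∀ (σ : ℝ), 0 ≤ σ →
      ∀ est : Matrix (Fin n) (Fin p) ℝ → Param n p r,
        (∀ X, (est X).IsGlobalOpt q X) →
        ((q : ℝ≥0∞) + 1) / n ≤ breakdownPoint est σ) := by
  refine ⟨⟨1024, by norm_num, ?_⟩, ?_⟩
  · intro n p r q hn hp _ hq σ hσ Ω _ μ _ E hE θstar _ θhat hopt θ hθ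
    exact oracle_inequality hn hp hq hσ hE hopt hθ
  · intro n p r q hn hp _ hq σ hσ est hest
    exact le_breakdownPoint hn hp hq hσ hest
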